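/- For a finite collection $\mathcal F=\{F_1,\dots,F_s\}$ of homogeneous polynomials (forms) in $\mathbb C[x_0,\dots,x_n]$, with $d_i=\deg F_i$ not necessarily equal, the simultaneous Waring rank $\mathrm{rk}_{\mathbb C}\,\mathcal F$ is the least integer $r$ for which there are linear forms $L_1,\dots,L_r\in\mathbb C[x_0,\dots,x_n]$ such that every $F_i$ can be written as $F_i=\sum_{j=1}^r\lambda_{i,j}L_j^{d_i}$ with $\lambda_{i,j}\in\mathbb C$. For a single form $F$, its Waring rank is $\mathrm{rk}_{\mathbb C}\,F=\mathrm{rk}_{\mathbb C}\,\{F\}$. **Proposition.** Let $n\ge 0$ and let $M=x_0^{a_0}\cdots x_n^{a_n}$ be a monomial with integers $a_i>1$ for all $i$. Let $\mathcal M=\{\partial_{x_0}M,\dots,\partial_{x_n}M\}$ be the collection of its first partial derivatives. Then both ranks below are finite, and $$\mathrm{rk}_{\mathbb C}\,\mathcal M=\mathrm{rk}_{\mathbb C}\,M.$$ -/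

import Mathlib

/-- The forms in the set `𝓕` can be simultaneously decomposed by `r` linear forms: there are linear
forms `L 0, …, L (r - 1)` such that every `F ∈ 𝓕` is a `ℂ`-linear combination of the powers
`(L j) ^ deg F`. The degrees of the members of `𝓕` may differ, and so may the coefficients. -/
def HasSimultaneousWaringDecomposition {σ : Type*} (𝓕 : Set (MvPolynomial σ ℂ)) (r : ℕ) : Prop :=
  ∃ L : Fin r → MvPolynomial σ ℂ, (∀ j, (L j).IsHomogeneous 1) ∧
    ∀ F ∈ 𝓕, ∃ c : Fin r → ℂ, F = ∑ j, MvPolynomial.C (c j) * L j ^ F.totalDegree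

/-- The simultaneous Waring rank over `ℂ` of a collection of forms: the least number of linear forms
that decompose all of them simultaneously (`⊤` if there is no such number). -/
noncomputable def simultaneousWaringRank {σ : Type*} (𝓕 : Set (MvPolynomial σ ℂ)) : ℕ∞ :=
  ⨅ r ∈ {r : ℕ | HasSimultaneousWaringDecomposition 𝓕 r}, (r : ℕ∞)

/-- The Waring rank over `ℂ` of a single form. -/
noncomputable def waringRank {σ : Type*} (F : MvPolynomial σ ℂ) : ℕ∞ :=
  simultaneousWaringRank {F}

/-!
Let `k` be an index with `a k` minimal. Both ranks are equal to `∏ i ≠ k, (a i + 1)`.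

Give `ζ i` all `(a i + 1)`-th roots of unity for `i ≠ k`, put `ζ k = 1`, and sum
`(∏ i, ζ i) • (∑ i, ζ i • X i) ^ deg M` over all choices. Only the monomials `X ^ b` with
`a i + 1 ∣ b i + 1` for all `i ≠ k` survive; if `b ≠ a`, some `b i` with `i ≠ k` exceeds `a i` by at
least `a i + 1 > a k`, which the degree does not allow. So `M` has rank at most the product above,
and differentiating a decomposition of `M` decomposes all its partials with the same linear forms.

Conversely, `∂ₖ M` alone needs that many forms. It is a multiple of `X ^ e` with `e k = a k - 1 > 0`
and `e i = a i` otherwise. If `X ^ e = ∑ j, c j L j ^ deg e`, comparing coefficients shows that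
`f ↦ ∑ j, c j f(L j)`, where `f` is evaluated at the coefficient vector of `L j`, kills every
monomial of degree `deg e` other than `X ^ e`. Pairing `X ^ b` with `X ^ (e - b')`, homogenized by
powers of `X k`, is then triangular, so the functions `X ^ b / X k ^ deg b` with `b ≤ e`, `b k = 0`
are linearly independent on the set of the `L j`.
-/

open MvPolynomial Module

section LinearForms

variable {σ R : Type*} [CommSemiring R]

theorem exists_eq_linearCombination_X_of_isHomogeneous_one {L : MvPolynomial σ R}
    (hL : L.IsHomogeneous 1) : ∃ l : σ →₀ R, L = l.linearCombination R X := by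
  rw [← mem_homogeneousSubmodule, homogeneousSubmodule_one_eq_span_X,
    Finsupp.mem_span_range_iff_exists_finsupp] at hL
  exact hL.imp fun l hl ↦ hl.symm

theorem pderiv_eq_C_coeff_zero_of_isHomogeneous_one {L : MvPolynomial σ R}
    (hL : L.IsHomogeneous 1) (i : σ) : pderiv i L = C (coeff 0 (pderiv i L)) :=
  totalDegree_eq_zero_iff_eq_C.1 (Nat.le_zero.1 hL.pderiv.totalDegree_le)

theorem coeff_sum_C_mul_linearCombination_X_pow {J : Type*} [Fintype J] (c : J → R)
    (l : J → σ →₀ R) {b : σ →₀ ℕ} {d : ℕ} (hb : b.degree = d) :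
    coeff b (∑ j, C (c j) * (l j).linearCombination R (X : σ → MvPolynomial σ R) ^ d) =
      b.multinomial * ∑ j, c j * b.prod fun i n ↦ l j i ^ n := by
  simp only [coeff_sum, coeff_C_mul, coeff_linearCombination_X_pow, Finset.mul_sum]
  refine Finset.sum_congr rfl fun j _ ↦ ?_
  rw [if_pos (show b.sum (fun _ n ↦ n) = d from hb), mul_left_comm]

end LinearForms

section LowerBound

theorem linearIndependent_of_triangular_dual {ι κ R V : Type*} [LinearOrder κ] [CommRing R]
    [NoZeroDivisors R] [AddCommGroup V] [Module R V] {v : ι → V} {φ : ι → Dual R V} (deg : ι → κ)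
    (hdiag : ∀ i, φ i (v i) ≠ 0) (hlower : ∀ i j, deg j ≤ deg i → j ≠ i → φ i (v j) = 0) :
    LinearIndependent R v := by
  classical
  refine linearIndependent_iff'.2 fun s g hg ↦ ?_
  by_contra! ⟨i, hi, hgi⟩
  obtain ⟨t, ht, hmax⟩ := {j ∈ s | g j ≠ 0}.exists_max_image deg ⟨i, by simp [hi, hgi]⟩
  simp only [Finset.mem_filter, and_imp] at ht hmax
  have hφ : ∑ j ∈ s, g j * φ t (v j) = 0 := by simpa using congrArg (φ t) hg
  rw [Finset.sum_eq_single_of_mem t ht.1 fun j hj hjt ↦ ?_] at hφ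
  · exact mul_ne_zero ht.2 (hdiag t) hφ
  · obtain hgj | hgj := eq_or_ne (g j) 0
    · rw [hgj, zero_mul]
    · rw [hlower t j (hmax j hj hgj) hjt, mul_zero]

variable {σ : Type*} {e b b' : σ →₀ ℕ} {k : σ}

theorem degree_add_tsub_add_single (hb' : b' ≤ e) (hdeg : b.degree ≤ b'.degree) :
    (b + (e - b') + .single k (b'.degree - b.degree)).degree = e.degree := by
  have hsub : (e - b').degree + b'.degree = e.degree := by
    rw [← map_add, tsub_add_cancel_of_le hb']
  simp only [map_add, Finsupp.degree_single]
  lia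

theorem eq_of_add_tsub_add_single_eq {n : ℕ} (hb' : b' ≤ e) (hk : b k = b' k)
    (h : b + (e - b') + .single k n = e) : b = b' := by
  ext i
  obtain rfl | hi := eq_or_ne i k
  · exact hk
  · have hi' := DFunLike.congr_fun h i
    have := hb' i
    simp only [Finsupp.add_apply, Finsupp.tsub_apply, Finsupp.single_eq_of_ne hi] at hi'
    lia

theorem prod_pow_div_mul_prod_pow_tsub {K : Type*} [Field K] (p : σ → K) (hk : b' k < e k)
    (hdeg : b.degree ≤ b'.degree) :
    (b.prod fun i n ↦ p i ^ n) / p k ^ b.degree *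
        (((e - b').prod fun i n ↦ p i ^ n) * p k ^ b'.degree) =
      (b + (e - b') + .single k (b'.degree - b.degree)).prod fun i n ↦ p i ^ n := by
  classical
  have hadd (f g : σ →₀ ℕ) :
      ((f + g).prod fun i n ↦ p i ^ n) = (f.prod fun i n ↦ p i ^ n) * g.prod fun i n ↦ p i ^ n :=
    Finsupp.prod_add_index' (fun _ ↦ pow_zero _) fun _ _ _ ↦ pow_add _ _ _
  rw [hadd, hadd, Finsupp.prod_single_index (h := fun i n ↦ p i ^ n) (pow_zero _)]
  -- When `p k = 0` the quotient is junk, but both sides vanish since `b' k < e k`.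
  obtain hp | hp := eq_or_ne (p k) 0
  · have hkmem : k ∈ (e - b').support := by
      simpa [Nat.sub_eq_zero_iff_le] using hk
    have hzero : ((e - b').prod fun i n ↦ p i ^ n) = 0 :=
      Finset.prod_eq_zero hkmem (by simp only [hp, zero_pow (Finsupp.mem_support_iff.1 hkmem)])
    simp only [hzero, zero_mul, mul_zero]
  · rw [pow_sub₀ _ hp hdeg]
    ring

theorem finsupp_erase_le_self (f : σ →₀ ℕ) (k : σ) : f.erase k ≤ f := fun i ↦ by
  obtain rfl | hi := eq_or_ne i k
  · simp
  · rw [Finsupp.erase_ne hi]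

theorem card_Iic_le_card_of_moments {K J : Type*} [Field K] [Fintype J] [DecidableEq σ]
    (p : J → σ → K) (c : J → K)
    (hk : e k ≠ 0) (he : ∑ j, c j * e.prod (fun i n ↦ p j i ^ n) ≠ 0)
    (hne : ∀ b : σ →₀ ℕ, b.degree = e.degree → b ≠ e →
      ∑ j, c j * b.prod (fun i n ↦ p j i ^ n) = 0) :
    (Finset.Iic (e.erase k)).card ≤ Fintype.card J := by
  have hle (b : Finset.Iic (e.erase k)) : (b : σ →₀ ℕ) ≤ e :=
    (Finset.mem_Iic.1 b.2).trans (finsupp_erase_le_self e k)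
  have hbk (b : Finset.Iic (e.erase k)) : (b : σ →₀ ℕ) k = 0 := by
    simpa using Finset.mem_Iic.1 b.2 k
  let v (b : Finset.Iic (e.erase k)) (j : J) : K :=
    (b.1.prod fun i n ↦ p j i ^ n) / p j k ^ b.1.degree
  let φ (b : Finset.Iic (e.erase k)) : Dual K (J → K) :=
    Fintype.linearCombination K fun j ↦
      c j * (((e - b.1).prod fun i n ↦ p j i ^ n) * p j k ^ b.1.degree)
  have hφ (b' b : Finset.Iic (e.erase k)) (hdeg : b.1.degree ≤ b'.1.degree) : φ b' (v b) =
      ∑ j, c j * (b.1 + (e - b'.1) + .single k (b'.1.degree - b.1.degree)).prod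
        fun i n ↦ p j i ^ n := by
    rw [Fintype.linearCombination_apply]
    refine Finset.sum_congr rfl fun j _ ↦ ?_
    rw [← prod_pow_div_mul_prod_pow_tsub _ (by rw [hbk]; lia) hdeg, smul_eq_mul, mul_left_comm]
  have hv : LinearIndependent K v := by
    refine linearIndependent_of_triangular_dual (φ := φ) (fun b ↦ b.1.degree) (fun b ↦ ?_)
      fun b' b hdeg hbb' ↦ ?_
    · simpa [hφ b b le_rfl, add_tsub_cancel_of_le (hle b)] using he
    · rw [hφ b' b hdeg]
      refine hne _ (degree_add_tsub_add_single (hle b') hdeg) fun h ↦ hbb' (Subtype.ext ?_)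
      exact eq_of_add_tsub_add_single_eq (hle b') (by rw [hbk, hbk]) h
  simpa using hv.fintype_card_le_finrank

theorem card_Iic_eq_prod [DecidableEq σ] (f : σ →₀ ℕ) :
    (Finset.Iic f).card = f.prod fun _ n ↦ n + 1 := by
  simp [Finsupp.card_Iic, Finsupp.prod]

theorem prod_erase_le_card_of_monomial_eq_sum_pow {K J : Type*} [Field K] [CharZero K]
    [Fintype J] {z : K} (hz : z ≠ 0) (hk : e k ≠ 0)
    {L : J → MvPolynomial σ K} (hL : ∀ j, (L j).IsHomogeneous 1) {c : J → K}
    (h : monomial e z = ∑ j, C (c j) * L j ^ e.degree) :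
    ((e.erase k).prod fun _ n ↦ n + 1) ≤ Fintype.card J := by
  classical
  choose l hl using fun j ↦ exists_eq_linearCombination_X_of_isHomogeneous_one (hL j)
  have hmoment (b : σ →₀ ℕ) (hb : b.degree = e.degree) :
      b.multinomial * ∑ j, c j * b.prod (fun i n ↦ l j i ^ n) = if e = b then z else 0 := by
    simp only [← coeff_sum_C_mul_linearCombination_X_pow c l hb, ← hl, ← h, coeff_monomial]
  rw [← card_Iic_eq_prod]
  refine card_Iic_le_card_of_moments (fun j ↦ l j) c hk (fun h0 ↦ hz ?_) fun b hb hbe ↦ ?_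
  · simpa [h0] using (hmoment e rfl).symm
  · have hmul := hmoment b hb
    rw [if_neg hbe.symm] at hmul
    exact (mul_eq_zero.1 hmul).resolve_left (Nat.cast_ne_zero.2 (Nat.multinomial_pos _ _).ne')

end LowerBound

section UpperBound

theorem sum_rootsOfUnity_pow {R : Type*} [CommRing R] [IsDomain R] (m : ℕ) [NeZero m]
    [HasEnoughRootsOfUnity R m] [Fintype (rootsOfUnity m R)] (q : ℕ) :
    ∑ ζ : rootsOfUnity m R, ((ζ : Rˣ) : R) ^ q = if m ∣ q then (m : R) else 0 := by
  classical
  let χ : rootsOfUnity m R →* R :=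
    (powMonoidHom q).comp ((Units.coeHom R).comp (rootsOfUnity m R).subtype)
  have hχ : χ = 1 ↔ m ∣ q := by
    obtain ⟨ω, hω⟩ := HasEnoughRootsOfUnity.exists_primitiveRoot R m
    refine ⟨fun h ↦ (hω.pow_eq_one_iff_dvd q).1 ?_, fun h ↦ MonoidHom.ext fun ζ ↦ ?_⟩
    · simpa [χ] using DFunLike.congr_fun h hω.toRootsOfUnity
    · obtain ⟨t, rfl⟩ := h
      have := (mem_rootsOfUnity m (ζ : Rˣ)).1 ζ.2
      simp [χ, pow_mul, ← Units.val_pow_eq_pow_val, this]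
  calc ∑ ζ : rootsOfUnity m R, ((ζ : Rˣ) : R) ^ q = ∑ ζ, χ ζ := rfl
    _ = if m ∣ q then (m : R) else 0 := by
      simp only [sum_hom_units, hχ, Nat.cast_ite, Nat.cast_zero, ← Nat.card_eq_fintype_card,
        HasEnoughRootsOfUnity.natCard_rootsOfUnity]

variable {ι : Type*} [Fintype ι]

theorem sum_prod_rootsOfUnity_smul_sum_smul_pow [DecidableEq ι] {R A : Type*} [CommRing R]
    [IsDomain R] [CommSemiring A] [Algebra R A] (m : ι → ℕ) [∀ i, NeZero (m i)]
    [∀ i, HasEnoughRootsOfUnity R (m i)] [∀ i, Fintype (rootsOfUnity (m i) R)] (x : ι → A) (d : ℕ) :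
    ∑ ζ : ∀ i, rootsOfUnity (m i) R,
        (∏ i, ((ζ i : Rˣ) : R)) • (∑ i, ((ζ i : Rˣ) : R) • x i) ^ d =
      ∑ b ∈ Finset.univ.piAntidiag d with ∀ i, m i ∣ b i + 1,
        (Nat.multinomial Finset.univ b * ∏ i, m i) • ∏ i, x i ^ b i := by
  have hsum (b : ι → ℕ) : ∑ ζ : ∀ i, rootsOfUnity (m i) R, ∏ i, ((ζ i : Rˣ) : R) ^ (b i + 1) =
      if ∀ i, m i ∣ b i + 1 then ((∏ i, m i : ℕ) : R) else 0 := by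
    rw [← Fintype.prod_sum fun i (ζ : rootsOfUnity (m i) R) ↦ ((ζ : Rˣ) : R) ^ (b i + 1)]
    simp only [sum_rootsOfUnity_pow, Finset.prod_ite_zero, Finset.mem_univ, true_imp_iff,
      Nat.cast_prod]
  have hexpand (ζ : ∀ i, rootsOfUnity (m i) R) :
      (∏ i, ((ζ i : Rˣ) : R)) • (∑ i, ((ζ i : Rˣ) : R) • x i) ^ d =
        ∑ b ∈ Finset.univ.piAntidiag d, (∏ i, ((ζ i : Rˣ) : R) ^ (b i + 1)) •
          (Nat.multinomial Finset.univ b • ∏ i, x i ^ b i) := by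
    rw [Finset.sum_pow_eq_sum_piAntidiag, Finset.smul_sum]
    refine Finset.sum_congr rfl fun b _ ↦ ?_
    simp only [smul_pow, Finset.prod_smul, pow_succ', Finset.prod_mul_distrib, mul_smul,
      nsmul_eq_mul, mul_smul_comm]
  simp only [hexpand]
  rw [Finset.sum_comm, Finset.sum_filter]
  refine Finset.sum_congr rfl fun b _ ↦ ?_
  rw [← Finset.sum_smul, hsum, ite_smul, zero_smul, Nat.cast_smul_eq_nsmul, smul_smul, mul_comm]

theorem eq_of_add_one_dvd_add_one_of_sum_eq {a b : ι → ℕ} {k : ι} (hk : ∀ i, a k ≤ a i)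
    (hdvd : ∀ i ≠ k, a i + 1 ∣ b i + 1) (hsum : ∑ i, b i = ∑ i, a i) : b = a := by
  classical
  have hle : ∀ i ≠ k, a i ≤ b i := fun i hi ↦
    Nat.le_of_succ_le_succ (Nat.le_of_dvd (Nat.succ_pos _) (hdvd i hi))
  have hexcess : ∑ i ∈ Finset.univ.erase k, (b i - a i) ≤ a k := by
    rw [Finset.sum_tsub_distrib _ fun i hi ↦ hle i (Finset.ne_of_mem_erase hi)]
    rw [← Finset.add_sum_erase _ b (Finset.mem_univ k),
      ← Finset.add_sum_erase _ a (Finset.mem_univ k)] at hsum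
    lia
  have heq (i : ι) (hi : i ≠ k) : b i = a i := by
    have hle_excess : b i - a i ≤ ∑ j ∈ Finset.univ.erase k, (b j - a j) :=
      Finset.single_le_sum (f := fun j ↦ b j - a j) (fun _ _ ↦ Nat.zero_le _)
        (Finset.mem_erase.2 ⟨hi, Finset.mem_univ i⟩)
    have hdvd_sub : a i + 1 ∣ b i - a i := by
      simpa using Nat.dvd_sub (hdvd i hi) dvd_rfl
    have hzero : b i - a i = 0 := Nat.eq_zero_of_dvd_of_lt hdvd_sub (by have := hk i; lia)
    exact le_antisymm (Nat.sub_eq_zero_iff_le.1 hzero) (hle i hi)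
  have hk' : b k = a k := by
    rw [← Finset.add_sum_erase _ b (Finset.mem_univ k),
      ← Finset.add_sum_erase _ a (Finset.mem_univ k),
      Finset.sum_congr rfl fun i hi ↦ heq i (Finset.ne_of_mem_erase hi)] at hsum
    exact Nat.add_right_cancel hsum
  exact funext fun i ↦ (eq_or_ne i k).elim (fun h ↦ h ▸ hk') (heq i)

theorem exists_prod_pow_eq_sum_rootsOfUnity_smul_sum_smul_pow [DecidableEq ι] {K A : Type*}
    [Field K] [CharZero K] [CommSemiring A] [Algebra K A] {a m : ι → ℕ} {k : ι}
    (hk : ∀ i, a k ≤ a i) (hmk : m k = 1) (hm : ∀ i ≠ k, m i = a i + 1)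
    [∀ i, HasEnoughRootsOfUnity K (m i)] [∀ i, Fintype (rootsOfUnity (m i) K)] (x : ι → A) :
    ∃ c : (∀ i, rootsOfUnity (m i) K) → K,
      ∏ i, x i ^ a i = ∑ ζ, c ζ • (∑ i, ((ζ i : Kˣ) : K) • x i) ^ ∑ i, a i := by
  have hdvd (i : ι) : m i ∣ a i + 1 := by
    obtain rfl | hi := eq_or_ne i k
    · simp [hmk]
    · exact (hm i hi).dvd
  have (i : ι) : NeZero (m i) := ⟨ne_zero_of_dvd_ne_zero (Nat.succ_ne_zero _) (hdvd i)⟩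
  have hfilter :
      {b ∈ (Finset.univ : Finset ι).piAntidiag (∑ i, a i) | ∀ i, m i ∣ b i + 1} = {a} := by
    ext b
    simp only [Finset.mem_filter, Finset.mem_piAntidiag, Finset.mem_singleton]
    refine ⟨fun hb ↦ ?_, fun hb ↦ by simp [hb, hdvd]⟩
    exact eq_of_add_one_dvd_add_one_of_sum_eq hk (fun i hi ↦ hm i hi ▸ hb.2 i) hb.1.1
  have hne : ((Nat.multinomial Finset.univ a * ∏ i, m i : ℕ) : K) ≠ 0 :=
    Nat.cast_ne_zero.2 (mul_ne_zero (Nat.multinomial_pos _ _).ne'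
      (Finset.prod_ne_zero_iff.2 fun i _ ↦ NeZero.ne (m i)))
  refine ⟨fun ζ ↦ ((Nat.multinomial Finset.univ a * ∏ i, m i : ℕ) : K)⁻¹ *
    ∏ i, ((ζ i : Kˣ) : K), ?_⟩
  simp only [mul_smul, ← Finset.smul_sum]
  rw [sum_prod_rootsOfUnity_smul_sum_smul_pow, hfilter, Finset.sum_singleton,
    ← Nat.cast_smul_eq_nsmul K, inv_smul_smul₀ hne]

theorem exists_monomial_eq_sum_C_mul_pow {σ K : Type*} [Field K] [CharZero K]
    [∀ n : ℕ, HasEnoughRootsOfUnity K (n + 1)] {a : σ →₀ ℕ} {k : σ} (hk : k ∈ a.support)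
    (hmin : ∀ i ∈ a.support, a k ≤ a i) (z : K) :
    ∃ (L : Fin ((a.erase k).prod fun _ n ↦ n + 1) → MvPolynomial σ K) (c : _ → K),
      (∀ j, (L j).IsHomogeneous 1) ∧ monomial a z = ∑ j, C (c j) * L j ^ a.degree := by
  classical
  -- Erasing `k` makes the root of unity attached to `X k` trivial.
  let m (i : a.support) : ℕ := a.erase k i + 1
  let _ (i : a.support) : Fintype (rootsOfUnity (m i) K) := Fintype.ofFinite _
  have hcard : Fintype.card (∀ i, rootsOfUnity (m i) K) = (a.erase k).prod fun _ n ↦ n + 1 := by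
    rw [Finsupp.prod_of_support_subset _ (s := a.support) (by simp [Finset.erase_subset]) _
      (by simp), ← Finset.prod_coe_sort, Fintype.card_pi]
    simp only [← Nat.card_eq_fintype_card, m, HasEnoughRootsOfUnity.natCard_rootsOfUnity]
  let ζ := (Fintype.equivFinOfCardEq hcard).symm
  have hmonomial : monomial a (1 : K) = ∏ i : a.support, X i.1 ^ a i := by
    rw [Finset.prod_coe_sort a.support fun i ↦ (X i : MvPolynomial σ K) ^ a i,
      prod_X_pow_eq_monomial]
  have hdegree : ∑ i : a.support, a i = a.degree := Finset.sum_coe_sort a.support a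
  obtain ⟨c, hc⟩ := exists_prod_pow_eq_sum_rootsOfUnity_smul_sum_smul_pow (K := K)
    (a := fun i : a.support ↦ a i) (m := m) (k := ⟨k, hk⟩) (fun i ↦ hmin i i.2) (by simp [m])
    (fun i hi ↦ by simp [m, Finsupp.erase_ne (Subtype.coe_ne_coe.2 hi)])
    (fun i ↦ (X i.1 : MvPolynomial σ K))
  rw [← hmonomial, hdegree, ← ζ.sum_comp] at hc
  refine ⟨fun j ↦ ∑ i, ((ζ j i : Kˣ) : K) • X i.1, fun j ↦ z * c (ζ j), fun j ↦ ?_, ?_⟩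
  · exact .sum _ _ _ fun i _ ↦ by
      simpa only [smul_eq_C_mul] using (isHomogeneous_X K i.1).C_mul _
  · rw [← mul_one z, ← smul_eq_mul, ← smul_monomial, hc, Finset.smul_sum]
    simp only [smul_eq_C_mul, smul_eq_mul, mul_one, C_mul, mul_assoc]

end UpperBound

section WaringRank

variable {σ : Type*}

theorem exists_eq_sum_C_mul_pow_totalDegree_iff {R J : Type*} [CommSemiring R] [Fintype J]
    {F : MvPolynomial σ R} {d : ℕ} (hF : F.IsHomogeneous d) (L : J → MvPolynomial σ R) :
    (∃ c : J → R, F = ∑ j, C (c j) * L j ^ F.totalDegree) ↔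
      ∃ c : J → R, F = ∑ j, C (c j) * L j ^ d := by
  -- The zero form is homogeneous of every degree but has `totalDegree` zero.
  obtain rfl | hF0 := eq_or_ne F 0
  · exact iff_of_true ⟨0, by simp⟩ ⟨0, by simp⟩
  · rw [hF.totalDegree hF0]

theorem exists_pderiv_eq_sum_C_mul_pow {R J : Type*} [CommSemiring R] [Fintype J]
    {L : J → MvPolynomial σ R} (hL : ∀ j, (L j).IsHomogeneous 1) (c : J → R) (d : ℕ) (i : σ) :
    ∃ c' : J → R, pderiv i (∑ j, C (c j) * L j ^ d) = ∑ j, C (c' j) * L j ^ (d - 1) := by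
  refine ⟨fun j ↦ c j * d * coeff 0 (pderiv i (L j)), ?_⟩
  rw [map_sum]
  refine Finset.sum_congr rfl fun j _ ↦ ?_
  have hC := pderiv_eq_C_coeff_zero_of_isHomogeneous_one (hL j) i
  simp only [pderiv_C_mul, pderiv_pow, C_mul, map_natCast, ← hC]
  ring

theorem HasSimultaneousWaringDecomposition.range_pderiv {𝓕 : Set (MvPolynomial σ ℂ)} {r : ℕ}
    (h : HasSimultaneousWaringDecomposition 𝓕 r) {F : MvPolynomial σ ℂ} (hF𝓕 : F ∈ 𝓕) {d : ℕ}
    (hF : F.IsHomogeneous d) :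
    HasSimultaneousWaringDecomposition (Set.range fun i ↦ pderiv i F) r := by
  obtain ⟨L, hL, hdecomp⟩ := h
  obtain ⟨c, hc⟩ := (exists_eq_sum_C_mul_pow_totalDegree_iff hF L).1 (hdecomp F hF𝓕)
  refine ⟨L, hL, Set.forall_mem_range.2 fun i ↦ ?_⟩
  refine (exists_eq_sum_C_mul_pow_totalDegree_iff hF.pderiv L).2 ?_
  rw [hc]
  exact exists_pderiv_eq_sum_C_mul_pow hL c d i

theorem simultaneousWaringRank_le {𝓕 : Set (MvPolynomial σ ℂ)} {r : ℕ}
    (h : HasSimultaneousWaringDecomposition 𝓕 r) : simultaneousWaringRank 𝓕 ≤ r :=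
  iInf₂_le r h

theorem simultaneousWaringRank_range_pderiv_le {F : MvPolynomial σ ℂ} {d : ℕ}
    (hF : F.IsHomogeneous d) :
    simultaneousWaringRank (Set.range fun i ↦ pderiv i F) ≤ waringRank F :=
  le_iInf₂ fun _ hr ↦ simultaneousWaringRank_le (hr.range_pderiv (Set.mem_singleton F) hF)

theorem waringRank_monomial_le {a : σ →₀ ℕ} {k : σ} (hk : k ∈ a.support)
    (hmin : ∀ i ∈ a.support, a k ≤ a i) (z : ℂ) :
    waringRank (monomial a z) ≤ ((a.erase k).prod fun _ n ↦ n + 1 : ℕ) := by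
  obtain ⟨L, c, hL, hc⟩ := exists_monomial_eq_sum_C_mul_pow hk hmin z
  refine simultaneousWaringRank_le ⟨L, hL, fun F hF ↦ ?_⟩
  rw [Set.mem_singleton_iff.1 hF]
  exact (exists_eq_sum_C_mul_pow_totalDegree_iff (isHomogeneous_monomial z rfl) L).2 ⟨c, hc⟩

theorem prod_erase_le_simultaneousWaringRank {𝓕 : Set (MvPolynomial σ ℂ)} {e : σ →₀ ℕ} {z : ℂ}
    (he : monomial e z ∈ 𝓕) (hz : z ≠ 0) {k : σ} (hk : e k ≠ 0) :
    ((e.erase k).prod fun _ n ↦ n + 1 : ℕ) ≤ simultaneousWaringRank 𝓕 := by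
  refine le_iInf₂ fun r ⟨L, hL, hdecomp⟩ ↦ Nat.cast_le.2 ?_
  obtain ⟨c, hc⟩ := (exists_eq_sum_C_mul_pow_totalDegree_iff
    (isHomogeneous_monomial z rfl) L).1 (hdecomp _ he)
  simpa using prod_erase_le_card_of_monomial_eq_sum_pow hz hk hL hc

theorem prod_erase_le_simultaneousWaringRank_range_pderiv {a : σ →₀ ℕ} {z : ℂ} (hz : z ≠ 0)
    {k : σ} (hk : 1 < a k) :
    ((a.erase k).prod fun _ n ↦ n + 1 : ℕ) ≤
      simultaneousWaringRank (Set.range fun i ↦ pderiv i (monomial a z)) := by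
  have herase : (a - .single k 1).erase k = a.erase k := by
    ext i
    obtain rfl | hi := eq_or_ne i k
    · simp
    · simp [hi]
  have hmem : monomial (a - .single k 1) (z * a k) ∈
      Set.range fun i ↦ pderiv i (monomial a z) := ⟨k, pderiv_monomial⟩
  rw [← herase]
  refine prod_erase_le_simultaneousWaringRank hmem
    (mul_ne_zero hz (Nat.cast_ne_zero.2 (by lia))) ?_
  simp only [Finsupp.tsub_apply, Finsupp.single_eq_same]
  lia

end WaringRank

theorem mainTheorem5_general {σ : Type*} {a : σ →₀ ℕ} (ha0 : a ≠ 0) (ha : ∀ i ∈ a.support, 1 < a i)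
    {z : ℂ} (hz : z ≠ 0) :
    simultaneousWaringRank (Set.range fun i ↦ pderiv i (monomial a z)) ≠ ⊤ ∧
      waringRank (monomial a z) ≠ ⊤ ∧
      simultaneousWaringRank (Set.range fun i ↦ pderiv i (monomial a z)) =
        waringRank (monomial a z) := by
  obtain ⟨k, hk, hmin⟩ := a.support.exists_min_image a (Finsupp.support_nonempty_iff.2 ha0)
  have hlower := prod_erase_le_simultaneousWaringRank_range_pderiv hz (ha k hk)
  have hmono := simultaneousWaringRank_range_pderiv_le (isHomogeneous_monomial (d := a) z rfl)
  have hupper := waringRank_monomial_le hk hmin z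
  have hfinite : waringRank (monomial a z) ≠ ⊤ :=
    ne_top_of_le_ne_top (ENat.natCast_ne_top _) hupper
  exact ⟨ne_top_of_le_ne_top hfinite hmono, hfinite, hmono.antisymm (hupper.trans hlower)⟩

theorem mainTheorem5 (n : ℕ) (a : Fin (n + 1) → ℕ) (ha : ∀ i, 1 < a i)
    (M : MvPolynomial (Fin (n + 1)) ℂ) (hM : M = ∏ i, MvPolynomial.X i ^ a i) :
    simultaneousWaringRank (Set.range fun i : Fin (n + 1) => MvPolynomial.pderiv i M) ≠ ⊤ ∧
      waringRank M ≠ ⊤ ∧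
      simultaneousWaringRank (Set.range fun i : Fin (n + 1) => MvPolynomial.pderiv i M) =
        waringRank M := by
  have hmonomial : M = monomial (Finsupp.equivFunOnFinite.symm a) 1 := by
    simp [hM, monomial_eq, Finsupp.prod_fintype]
  have ha0 : Finsupp.equivFunOnFinite.symm a ≠ 0 := fun h ↦
    (zero_lt_one.trans (ha 0)).ne' (DFunLike.congr_fun h 0)
  exact hmonomial ▸ mainTheorem5_general ha0 (fun i _ ↦ ha i) one_ne_zero
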